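/- Fix an inner product and an orthonormal basis $e_1,\dots,e_n$ of $\mathbb{R}^n$, and write $x(l)$ for the $l$-th coordinate of $x\in\mathbb{R}^n$ in this basis. A convex body is a compact convex set with non-empty interior; a set $K$ is symmetric if $K=-K$, and it is unconditional if, for all signs $\delta_1,\dots,\delta_n\in\{-1,1\}$ and all $x\in\mathbb{R}^n$, one has $x\in K$ if and only if $\sum_{l=1}^n\delta_l\,x(l)\,e_l\in K$. For integers $1\le j\le k$ put $$\mathcal{E}_j(x_1,\dots,x_k):=\binom{k}{j}^{-1}\sum_{l=1}^n\ \sum_{1\le i_1<\dots<i_j\le k}x_{i_1}(l)\cdots x_{i_j}(l),\qquad x_1,\dots,x_k\in\mathbb{R}^n,$$ and say that sets $K_1,\dots,K_k\subseteq\mathbb{R}^n$ satisfy the $\mathcal{E}_j$-polarity condition if $\mathcal{E}_j(x_1,\dots,x_k)\le 1$ whenever $x_i\in K_i$ for $i=1,\dots,k$. Let $|\cdot|$ denote volume. Let $2\le j\le k$ be integers and let $K_1,\dots,K_k$ be symmetric convex bodies in $\mathbb{R}^n$ satisfying the $\mathcal{E}_j$-polarity condition. Assume that one of the following holds: (i)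 $j=k$; (ii) $j$ is even and $K_3,\dots,K_k$ are unconditional. Then there exist unconditional convex bodies $U_1,\dots,U_k$ in $\mathbb{R}^n$ satisfying the $\mathcal{E}_j$-polarity condition such that $$\prod_{i=1}^k|K_i|\le\prod_{i=1}^k|U_i|.$$ -/

import Mathlib

open MeasureTheory
open scoped Pointwise

noncomputable section

namespace Santalo

/-- A convex body: a convex compact set with non-empty interior.
(Mathlib's `ConvexBody` only asks for the set itself to be non-empty.) -/
structure IsConvexBody {E : Type*} [NormedAddCommGroup E] [NormedSpace ℝ E] (K : Set E) :
    Prop where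
  convex : Convex ℝ K
  isCompact : IsCompact K
  interior_nonempty : (interior K).Nonempty

/-- A symmetric convex body: a convex body `K` with `K = -K`. -/
structure IsSymmetricConvexBody {E : Type*} [NormedAddCommGroup E] [NormedSpace ℝ E]
    (K : Set E) : Prop where
  isConvexBody : IsConvexBody K
  symmetric : K = -K

/-- The vector `(δ₁ x₁, …, δₙ xₙ)`, where `xₗ` are the coordinates of `x` with respect to `b`. -/
def coordMul {n : ℕ} {E : Type*} [NormedAddCommGroup E] [InnerProductSpace ℝ E]
    (b : OrthonormalBasis (Fin n) ℝ E) (δ : Fin n → ℝ) (x : E) : E :=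
  ∑ l, (δ l * b.repr x l) • b l

/-- A set `A` is unconditional (with respect to the basis `b`) if membership in `A`
is unaffected by changing the signs of coordinates. -/
def IsUnconditional {n : ℕ} {E : Type*} [NormedAddCommGroup E] [InnerProductSpace ℝ E]
    (b : OrthonormalBasis (Fin n) ℝ E) (A : Set E) : Prop :=
  ∀ δ : Fin n → ℝ, (∀ l, δ l = 1 ∨ δ l = -1) → ∀ x : E, coordMul b δ x ∈ A ↔ x ∈ A

/-- The elementary symmetric polynomial `s_j(r₁, …, r_k)`. -/
def elemSymm {k : ℕ} (j : ℕ) (r : Fin k → ℝ) : ℝ :=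
  ∑ t ∈ Finset.powersetCard j (Finset.univ : Finset (Fin k)), ∏ i ∈ t, r i

/-- `elemSymm` is the evaluation of Mathlib's elementary symmetric polynomial. -/
theorem elemSymm_eq_eval_esymm {k : ℕ} (j : ℕ) (r : Fin k → ℝ) :
    elemSymm j r = MvPolynomial.eval r (MvPolynomial.esymm (Fin k) ℝ j) := by
  simp [elemSymm, MvPolynomial.esymm]

/-- `𝒮_j(x₁, …, x_k) = ∑ₗ s_j(x₁(l), …, x_k(l))`. -/
def calS {n k : ℕ} {E : Type*} [NormedAddCommGroup E] [InnerProductSpace ℝ E]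
    (b : OrthonormalBasis (Fin n) ℝ E) (j : ℕ) (x : Fin k → E) : ℝ :=
  ∑ l : Fin n, elemSymm j (fun i => b.repr (x i) l)

/-- `ℰ_j = 𝒮_j / (k choose j)`. -/
def calE {n k : ℕ} {E : Type*} [NormedAddCommGroup E] [InnerProductSpace ℝ E]
    (b : OrthonormalBasis (Fin n) ℝ E) (j : ℕ) (x : Fin k → E) : ℝ :=
  calS b j x / (k.choose j : ℝ)

/-- The sets `K₁, …, K_k` satisfy the `Φ`-polarity condition. -/
def PolarityCondition {k : ℕ} {E : Type*} (Φ : (Fin k → E) → ℝ) (K : Fin k → Set E) : Prop :=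
  ∀ x : Fin k → E, (∀ i, x i ∈ K i) → Φ x ≤ 1

end Santalo

end

namespace Santalo

/-! Each $K_i$ is made unconditional by finitely many volume-nondecreasing moves that preserve
polarity. A move picks two indices $p\ne q$ and a coordinate $l$: `partialSymm {l}` is applied to
$K_p$ (Steiner symmetrization along $e_l$) and `partialSymm {l}ᶜ` to $K_q$ (each slice $L$ at a
fixed $l$-th coordinate becomes $(L-L)/2$). By Fubini and Brunn–Minkowski on the slices, neither
volume drops.

Polarity survives (`polarityCondition_symmPair`) because $\mathcal{E}_j$ at a point of the new sets
is the mean of its values at two points of the old ones: $s_j$ is affine in each variable, the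
averaging is done in $x_p$ for the coordinate $l$ and in $x_q$ for the others, and the sign change
this causes at $l$ is absorbed by $j=k$ or by $j$ even. A move makes the $p$-th set invariant under
the $l$-th reflection and destroys no earlier invariance, so running over all pairs $(p,l)$
suffices. -/

/-! ### Brunn–Minkowski for midpoints, via Prékopa–Leindler -/

theorem volume_add_le_of_isCompact {A B : Set ℝ} (hA : IsCompact A) (hB : IsCompact B)
    (hA0 : A.Nonempty) (hB0 : B.Nonempty) : volume A + volume B ≤ volume (A + B) := by
  obtain ⟨a, haA, ha⟩ := hA.exists_isGreatest hA0
  obtain ⟨c, hcB, hc⟩ := hB.exists_isLeast hB0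
  have h1 : volume ((fun x => c + x) '' A) = volume A := by
    rw [Set.image_add_left, measure_preimage_add]
  have h2 : volume ((fun x => a + x) '' B) = volume B := by
    rw [Set.image_add_left, measure_preimage_add]
  -- As `a` is the maximum of `A` and `c` the minimum of `B`, the two translates meet at most at `a
  -- + c`.
  have hd : AEDisjoint volume ((fun x => c + x) '' A) ((fun x => a + x) '' B) := by
    refine measure_mono_null (t := {a + c}) ?_ (by simp)
    rintro _ ⟨⟨x, hx, rfl⟩, ⟨y, hy, h⟩⟩
    have := ha hx
    have := hc hy
    simp only [Set.mem_singleton_iff] at *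
    linarith
  have hm : MeasurableSet ((fun x => a + x) '' B) :=
    (hB.image (continuous_const.add continuous_id)).measurableSet
  rw [← h1, ← h2, ← measure_union₀ hm.nullMeasurableSet hd]
  apply measure_mono
  rintro _ (⟨x, hx, rfl⟩ | ⟨x, hx, rfl⟩)
  · exact ⟨x, hx, c, hcB, add_comm _ _⟩
  · exact ⟨a, haA, x, hx, rfl⟩

/-- The one-dimensional Brunn–Minkowski inequality. -/
theorem volume_add_le {A B : Set ℝ} (hA : MeasurableSet A) (hB : MeasurableSet B)
    (hA0 : A.Nonempty) (hB0 : B.Nonempty) : volume A + volume B ≤ volume (A + B) := by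
  obtain ⟨a, ha⟩ := hA0
  obtain ⟨c, hc⟩ := hB0
  rw [hA.measure_eq_iSup_isCompact, hB.measure_eq_iSup_isCompact]
  simp only [iSup_and']
  refine ENNReal.biSup_add_biSup_le' (p := fun s => s ⊆ A ∧ IsCompact s)
    (q := fun s => s ⊆ B ∧ IsCompact s) ⟨∅, by simp⟩ ⟨∅, by simp⟩ fun s hs t ht => ?_
  -- Adjoining `a` and `c` keeps the compact approximations nonempty.
  calc volume s + volume t ≤ _ := add_le_add (measure_mono Set.subset_union_left)
        (measure_mono Set.subset_union_left)
    _ ≤ _ := volume_add_le_of_isCompact (hs.2.union (isCompact_singleton (x := a)))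
        (ht.2.union (isCompact_singleton (x := c))) (by simp) (by simp)
    _ ≤ _ := measure_mono (Set.add_subset_add (by simp [hs.1, ha, Set.insert_subset_iff])
        (by simp [ht.1, hc, Set.insert_subset_iff]))

theorem _root_.ENNReal.four_mul_mul_le_add_sq (a b : ENNReal) : 4 * (a * b) ≤ (a + b) ^ 2 := by
  wlog h : a ≤ b generalizing a b
  · rw [add_comm, mul_comm a]
    exact this b a (le_of_not_ge h)
  obtain ⟨d, rfl⟩ := exists_add_of_le h
  calc 4 * (a * (a + d)) ≤ 4 * (a * (a + d)) + d ^ 2 := le_self_add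
    _ = _ := by ring

/-- The set of midpoints of segments from `A` to `B`. -/
def midpointSet {G : Type*} [AddCommGroup G] [Module ℝ G] (A B : Set G) : Set G :=
  (fun p : G × G => (1 / 2 : ℝ) • (p.1 + p.2)) '' (A ×ˢ B)

theorem volume_midpointSet_real (A B : Set ℝ) :
    volume (A + B) = 2 * volume (midpointSet A B) := by
  have : A + B = (2 : ℝ) • midpointSet A B := by
    ext x
    simp only [Set.mem_add, midpointSet, Set.mem_smul_set, Set.mem_image, Set.mem_prod, Prod.exists]
    constructor
    · rintro ⟨a, ha, c, hc, rfl⟩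
      exact ⟨_, ⟨a, c, ⟨ha, hc⟩, rfl⟩, by simp⟩
    · rintro ⟨_, ⟨a, c, ⟨ha, hc⟩, rfl⟩, rfl⟩
      exact ⟨a, ha, c, hc, by simp⟩
  rw [this, Measure.addHaar_smul]
  simp

/-- Layer-cake formula: for `t < 1` the sets `{f > t}` and `{g > t}` are both nonempty with
midpoints in `{h > t}`, so one-dimensional Brunn–Minkowski applies; for `t ≥ 1` both are empty. This
is why the suprema are normalized alike. -/
theorem lintegral_add_le_of_isLUB_one {f g h : ℝ → ℝ} (hf : Measurable f) (hg : Measurable g)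
    (hh : Measurable h) (hf0 : 0 ≤ f) (hg0 : 0 ≤ g) (hh0 : 0 ≤ h)
    (hf1 : IsLUB (Set.range f) 1) (hg1 : IsLUB (Set.range g) 1)
    (hfg : ∀ s t, f s * g t ≤ h ((1 / 2) * (s + t)) ^ 2) :
    (∫⁻ s, ENNReal.ofReal (f s)) + ∫⁻ s, ENNReal.ofReal (g s) ≤
      2 * ∫⁻ s, ENNReal.ofReal (h s) := by
  rw [lintegral_eq_lintegral_meas_lt _ (Filter.Eventually.of_forall hf0) hf.aemeasurable,
    lintegral_eq_lintegral_meas_lt _ (Filter.Eventually.of_forall hg0) hg.aemeasurable,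
    lintegral_eq_lintegral_meas_lt _ (Filter.Eventually.of_forall hh0) hh.aemeasurable,
    ← lintegral_const_mul' _ _ (by simp), ← lintegral_add_left]
  swap
  · exact Antitone.measurable fun s t hst => measure_mono fun x hx => lt_of_le_of_lt hst hx
  refine setLIntegral_mono' measurableSet_Ioi fun t (ht : 0 < t) => ?_
  rcases le_or_gt 1 t with h1 | h1
  · have e1 : {a | t < f a} = ∅ := by
      ext a
      simpa using (hf1.1 ⟨a, rfl⟩).trans h1
    have e2 : {a | t < g a} = ∅ := by
      ext a
      simpa using (hg1.1 ⟨a, rfl⟩).trans h1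
    simp [e1, e2]
  · obtain ⟨_, ⟨a, rfl⟩, ha, -⟩ := hf1.exists_between h1
    obtain ⟨_, ⟨c, rfl⟩, hc, -⟩ := hg1.exists_between h1
    refine (volume_add_le (measurableSet_lt measurable_const hf)
      (measurableSet_lt measurable_const hg) ⟨a, ha⟩ ⟨c, hc⟩).trans ?_
    rw [volume_midpointSet_real]
    gcongr
    rintro _ ⟨⟨x, y⟩, ⟨hx, hy⟩, rfl⟩
    simp only [Set.mem_ofPred_eq, smul_eq_mul] at *
    refine lt_of_pow_lt_pow_left₀ 2 (hh0 _) (lt_of_lt_of_le ?_ (hfg x y))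
    rw [sq]
    exact mul_lt_mul'' hx hy ht.le ht.le

/-- The midpoint case of the one-dimensional Prékopa–Leindler inequality. -/
theorem lintegral_mul_lintegral_le_sq {f g h : ℝ → ℝ} (hf : Measurable f) (hg : Measurable g)
    (hh : Measurable h) (hf0 : 0 ≤ f) (hg0 : 0 ≤ g) (hh0 : 0 ≤ h)
    (hfb : BddAbove (Set.range f)) (hgb : BddAbove (Set.range g))
    (hfg : ∀ s t, f s * g t ≤ h ((1 / 2) * (s + t)) ^ 2) :
    (∫⁻ s, ENNReal.ofReal (f s)) * ∫⁻ s, ENNReal.ofReal (g s) ≤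
      (∫⁻ s, ENNReal.ofReal (h s)) ^ 2 := by
  have key : ∀ φ : ℝ → ℝ, 0 ≤ φ → BddAbove (Set.range φ) → (∫⁻ s, ENNReal.ofReal (φ s)) ≠ 0 →
      ∃ M, 0 < M ∧ IsLUB (Set.range fun s => φ s / M) 1 := by
    intro φ h0 hb hne
    have hl := isLUB_csSup (Set.range_nonempty φ) hb
    set M := sSup (Set.range φ)
    have hM : 0 < M := by
      by_contra hM
      apply hne
      have : ∀ s, ENNReal.ofReal (φ s) = 0 := fun s =>
        ENNReal.ofReal_of_nonpos ((hl.1 ⟨s, rfl⟩).trans (not_lt.1 hM))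
      simp [this]
    refine ⟨M, hM, ?_, ?_⟩
    · rintro _ ⟨s, rfl⟩
      exact (div_le_one hM).2 (hl.1 ⟨s, rfl⟩)
    · intro c hc
      have : M ≤ c * M := hl.2 (by
        rintro _ ⟨s, rfl⟩
        exact (div_le_iff₀ hM).1 (hc ⟨s, rfl⟩))
      exact le_of_mul_le_mul_right (by simpa using this) hM
  by_cases hf' : (∫⁻ s, ENNReal.ofReal (f s)) = 0
  · simp [hf']
  by_cases hg' : (∫⁻ s, ENNReal.ofReal (g s)) = 0
  · simp [hg']
  obtain ⟨M, hM, hfM⟩ := key f hf0 hfb hf'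
  obtain ⟨N, hN, hgN⟩ := key g hg0 hgb hg'
  have hsq : √(M * N) ^ 2 = M * N := Real.sq_sqrt (by positivity)
  have hS : 0 < √(M * N) := Real.sqrt_pos.2 (by positivity)
  -- Scaling `h` by the geometric mean of the two suprema preserves the hypothesis; squaring and
  -- AM-GM then give the product form.
  have main := lintegral_add_le_of_isLUB_one (hf.div_const M) (hg.div_const N)
    (hh.div_const √(M * N)) (fun s => div_nonneg (hf0 s) hM.le) (fun s => div_nonneg (hg0 s) hN.le)
    (fun s => div_nonneg (hh0 s) hS.le) hfM hgN (fun s t => by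
      simp only [div_pow, hsq, div_mul_div_comm]
      gcongr
      exact hfg s t)
  have scale : ∀ (φ : ℝ → ℝ) (c : ℝ), 0 ≤ c → Measurable φ → ∫⁻ s, ENNReal.ofReal (φ s / c) =
      ENNReal.ofReal c⁻¹ * ∫⁻ s, ENNReal.ofReal (φ s) := by
    intro φ c hc hφ
    rw [← lintegral_const_mul _ hφ.ennreal_ofReal]
    refine lintegral_congr fun s => ?_
    rw [div_eq_inv_mul, ENNReal.ofReal_mul (by positivity)]
  rw [scale f M hM.le hf, scale g N hN.le hg, scale h _ hS.le hh] at main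
  set F := ∫⁻ s, ENNReal.ofReal (f s)
  set G := ∫⁻ s, ENNReal.ofReal (g s)
  set H := ∫⁻ s, ENNReal.ofReal (h s)
  have h3 : ENNReal.ofReal (M * N)⁻¹ * (F * G) ≤ ENNReal.ofReal (M * N)⁻¹ * H ^ 2 := by
    have h4 := (ENNReal.four_mul_mul_le_add_sq _ _).trans (pow_le_pow_left' main 2)
    have e1 : 4 * (ENNReal.ofReal M⁻¹ * F * (ENNReal.ofReal N⁻¹ * G)) =
        4 * (ENNReal.ofReal (M * N)⁻¹ * (F * G)) := by
      rw [mul_inv, ENNReal.ofReal_mul (by positivity)]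
      ring
    have e2 : (2 * (ENNReal.ofReal (√(M * N))⁻¹ * H)) ^ 2 =
        4 * (ENNReal.ofReal (M * N)⁻¹ * H ^ 2) := by
      have : (M * N)⁻¹ = (√(M * N))⁻¹ ^ 2 := by rw [inv_pow, hsq]
      rw [this, ENNReal.ofReal_pow (by positivity)]
      ring
    rw [e1, e2] at h4
    exact (ENNReal.mul_le_mul_iff_right (by simp) (by simp)).1 h4
  exact (ENNReal.mul_le_mul_iff_right (by simp; positivity) (by simp)).1 h3

/-- The multiplicative Brunn–Minkowski inequality for midpoints of compact sets in `G`. -/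
def MidpointBrunnMinkowski (G : Type*) [NormedAddCommGroup G] [NormedSpace ℝ G]
    [MeasureSpace G] : Prop :=
  ∀ A B : Set G, IsCompact A → IsCompact B →
    volume A * volume B ≤ volume (midpointSet A B) ^ 2

theorem isCompact_midpointSet {G : Type*} [NormedAddCommGroup G] [NormedSpace ℝ G] {A B : Set G}
    (hA : IsCompact A) (hB : IsCompact B) : IsCompact (midpointSet A B) :=
  (hA.prod hB).image (by fun_prop)

theorem midpointBrunnMinkowski_real : MidpointBrunnMinkowski ℝ := by
  intro A B hA hB
  rcases A.eq_empty_or_nonempty with rfl | hA0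
  · simp
  rcases B.eq_empty_or_nonempty with rfl | hB0
  · simp
  have h1 := volume_add_le hA.measurableSet hB.measurableSet hA0 hB0
  rw [volume_midpointSet_real] at h1
  have h2 := (ENNReal.four_mul_mul_le_add_sq _ _).trans (pow_le_pow_left' h1 2)
  rw [mul_pow, show (2 : ENNReal) ^ 2 = 4 by norm_num] at h2
  exact (ENNReal.mul_le_mul_iff_right (by simp) (by simp)).1 h2

/-- Prékopa–Leindler is applied to the slice volumes as functions on `ℝ`; its hypothesis is the
inequality in `G`. -/
theorem MidpointBrunnMinkowski.real_prod {G : Type*} [NormedAddCommGroup G] [NormedSpace ℝ G]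
    [MeasureSpace G] [BorelSpace G] [SecondCountableTopology G]
    [SFinite (volume : Measure G)] [IsFiniteMeasureOnCompacts (volume : Measure G)]
    (hG : MidpointBrunnMinkowski G) : MidpointBrunnMinkowski (ℝ × G) := by
  intro A B hA hB
  have hC := isCompact_midpointSet hA hB
  have hmono : ∀ (D : Set (ℝ × G)) (s : ℝ), Prod.mk s ⁻¹' D ⊆ Prod.snd '' D :=
    fun D s y hy => ⟨(s, y), hy, rfl⟩
  have hfin : ∀ D : Set (ℝ × G), IsCompact D → ∀ s, volume (Prod.mk s ⁻¹' D) ≠ ⊤ :=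
    fun D hD s => ((measure_mono (hmono D s)).trans_lt
      (hD.image continuous_snd).measure_lt_top).ne
  have hint : ∀ D : Set (ℝ × G), IsCompact D →
      volume D = ∫⁻ s, ENNReal.ofReal (volume (Prod.mk s ⁻¹' D)).toReal := by
    intro D hD
    rw [Measure.volume_eq_prod, Measure.prod_apply hD.measurableSet]
    exact lintegral_congr fun s => (ENNReal.ofReal_toReal (hfin D hD s)).symm
  have hmeas : ∀ D : Set (ℝ × G), IsCompact D →
      Measurable fun s => (volume (Prod.mk s ⁻¹' D)).toReal :=
    fun D hD => (measurable_measure_prodMk_left hD.measurableSet).ennreal_toReal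
  have hbdd : ∀ D : Set (ℝ × G), IsCompact D →
      BddAbove (Set.range fun s => (volume (Prod.mk s ⁻¹' D)).toReal) := by
    rintro D hD
    refine ⟨(volume (Prod.snd '' D)).toReal, ?_⟩
    rintro _ ⟨s, rfl⟩
    exact ENNReal.toReal_mono (hD.image continuous_snd).measure_lt_top.ne
      (measure_mono (hmono D s))
  have hsec : ∀ D : Set (ℝ × G), IsCompact D → ∀ s, IsCompact (Prod.mk s ⁻¹' D) := fun D hD s =>
    (hD.image continuous_snd).of_isClosed_subset
      (hD.isClosed.preimage (by fun_prop)) (hmono D s)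
  rw [hint A hA, hint B hB, hint _ hC]
  refine lintegral_mul_lintegral_le_sq (hmeas A hA) (hmeas B hB) (hmeas _ hC)
    (fun _ => ENNReal.toReal_nonneg) (fun _ => ENNReal.toReal_nonneg)
    (fun _ => ENNReal.toReal_nonneg) (hbdd A hA) (hbdd B hB) fun s t => ?_
  rw [← ENNReal.toReal_mul, ← ENNReal.toReal_pow]
  refine ENNReal.toReal_mono (by simpa using hfin _ hC _) ?_
  refine (hG _ _ (hsec A hA s) (hsec B hB t)).trans ?_
  gcongr
  rintro _ ⟨⟨y, z⟩, ⟨hy, hz⟩, rfl⟩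
  exact ⟨((s, y), (t, z)), ⟨hy, hz⟩, by simp⟩

theorem MidpointBrunnMinkowski.of_measurePreserving {G H : Type*} [NormedAddCommGroup G]
    [NormedSpace ℝ G] [MeasureSpace G] [BorelSpace G] [NormedAddCommGroup H] [NormedSpace ℝ H]
    [MeasureSpace H] [BorelSpace H] (hH : MidpointBrunnMinkowski H) (e : G ≃L[ℝ] H)
    (he : MeasurePreserving e volume volume) : MidpointBrunnMinkowski G := by
  have hvol : ∀ D : Set G, volume (e '' D) = volume D := fun D => by
    rw [← he.measure_preimage_equiv (f := e.toHomeomorph.toMeasurableEquiv)]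
    congr 1
    exact e.injective.preimage_image D
  intro A B hA hB
  rw [← hvol A, ← hvol B, ← hvol (midpointSet A B)]
  refine (hH _ _ (hA.image e.continuous) (hB.image e.continuous)).trans ?_
  gcongr
  rintro _ ⟨⟨_, _⟩, ⟨⟨y, hy, rfl⟩, ⟨z, hz, rfl⟩⟩, rfl⟩
  exact ⟨_, ⟨(y, z), ⟨hy, hz⟩, rfl⟩, by simp⟩

/-- Separating one coordinate, as a continuous linear equivalence. -/
def splitCoord {m : ℕ} (l : Fin (m + 1)) : (Fin (m + 1) → ℝ) ≃L[ℝ] ℝ × (Fin m → ℝ) where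
  toFun x := (x l, fun i => x (l.succAbove i))
  invFun p := l.insertNth (α := fun _ => ℝ) p.1 p.2
  map_add' _ _ := rfl
  map_smul' _ _ := rfl
  left_inv x := l.insertNth_self_removeNth x
  right_inv p := by simp
  continuous_toFun := by fun_prop
  continuous_invFun := Continuous.finInsertNth l continuous_fst continuous_snd

theorem measurePreserving_splitCoord {m : ℕ} (l : Fin (m + 1)) :
    MeasurePreserving (splitCoord l) volume volume :=
  volume_preserving_piFinSuccAbove (fun _ => ℝ) l

theorem midpointBrunnMinkowski_pi (m : ℕ) : MidpointBrunnMinkowski (Fin m → ℝ) := by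
  induction m with
  | zero =>
    intro A B _ _
    rcases A.eq_empty_or_nonempty with rfl | hA0
    · simp
    rcases B.eq_empty_or_nonempty with rfl | hB0
    · simp
    have hC : (midpointSet A B).Nonempty := (hA0.prod hB0).image _
    rw [Subsingleton.eq_univ_of_nonempty hC, Subsingleton.eq_univ_of_nonempty hA0,
      Subsingleton.eq_univ_of_nonempty hB0, sq]
  | succ m ih => exact ih.real_prod.of_measurePreserving _ (measurePreserving_splitCoord 0)

/-! ### Volume under slicewise symmetrization -/

/-- A slice `L` of `K` and its negative have equal volume, so Brunn–Minkowski bounds that volume by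
the one of their midpoint set, which lies in the slice of `K'`. -/
theorem volume_le_of_fiber {F G : Type*} [NormedAddCommGroup F] [NormedSpace ℝ F]
    [FiniteDimensional ℝ F] [MeasureSpace F] [BorelSpace F]
    [(volume : Measure F).IsAddHaarMeasure] [NormedAddCommGroup G] [NormedSpace ℝ G]
    [FiniteDimensional ℝ G] [MeasureSpace G] [BorelSpace G]
    [(volume : Measure G).IsAddHaarMeasure] (hF : MidpointBrunnMinkowski F) {K K' : Set (F × G)}
    (hK : IsCompact K) (hK' : IsCompact K')
    (h : ∀ y y' z, (y, z) ∈ K → (y', z) ∈ K → ((1 / 2 : ℝ) • (y + -y'), z) ∈ K') :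
    volume K ≤ volume K' := by
  have := FiniteDimensional.proper ℝ F
  have := FiniteDimensional.proper ℝ G
  rw [Measure.volume_eq_prod, Measure.prod_apply_symm hK.measurableSet,
    Measure.prod_apply_symm hK'.measurableSet]
  refine lintegral_mono fun z => ?_
  have hc : IsCompact ((fun y => (y, z)) ⁻¹' K) :=
    (hK.image continuous_fst).of_isClosed_subset (hK.isClosed.preimage (by fun_prop))
      fun y hy => ⟨(y, z), hy, rfl⟩
  have h1 := hF _ _ hc hc.neg
  rw [Measure.measure_neg, ← sq] at h1
  refine (le_of_not_gt fun hlt =>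
    (ENNReal.pow_lt_pow_left two_ne_zero hlt).not_ge h1).trans (measure_mono ?_)
  rintro _ ⟨⟨y, y'⟩, ⟨hy, hy'⟩, rfl⟩
  simpa using h y (-y') z hy hy'

theorem volume_le_of_measurePreserving {E F G : Type*} [NormedAddCommGroup E] [NormedSpace ℝ E]
    [MeasureSpace E] [BorelSpace E] [NormedAddCommGroup F] [NormedSpace ℝ F]
    [FiniteDimensional ℝ F] [MeasureSpace F] [BorelSpace F]
    [(volume : Measure F).IsAddHaarMeasure] [NormedAddCommGroup G] [NormedSpace ℝ G]
    [FiniteDimensional ℝ G] [MeasureSpace G] [BorelSpace G]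
    [(volume : Measure G).IsAddHaarMeasure] (hF : MidpointBrunnMinkowski F)
    (e : E ≃L[ℝ] F × G) (he : MeasurePreserving e volume volume) {K K' : Set E}
    (hK : IsCompact K) (hK' : IsCompact K')
    (h : ∀ u ∈ K, ∀ v ∈ K, ∀ x, (e u).2 = (e x).2 → (e v).2 = (e x).2 →
      (e x).1 = (1 / 2 : ℝ) • ((e u).1 + -(e v).1) → x ∈ K') :
    volume K ≤ volume K' := by
  have := FiniteDimensional.proper ℝ F
  have hvol : ∀ D : Set E, IsCompact D → volume (e '' D) = volume D := fun D hD => by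
    rw [← he.measure_preimage (hD.image e.continuous).measurableSet.nullMeasurableSet,
      e.injective.preimage_image]
  rw [← hvol K hK, ← hvol K' hK']
  refine volume_le_of_fiber hF (hK.image e.continuous) (hK'.image e.continuous) ?_
  rintro y y' z ⟨u, hu, hu'⟩ ⟨v, hv, hv'⟩
  refine ⟨e.symm ((1 / 2 : ℝ) • (y + -y'), z), h u hu v hv _ ?_ ?_ ?_, by simp⟩ <;>
    simp [hu', hv']

/-! ### Symmetrization in a set of coordinates -/

section partialSymm

variable {ι : Type*}

/-- Symmetrization of `K` in the coordinates belonging to `S`. For `S = {l}` this is the Steiner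
symmetrization of a convex body in the direction of the `l`-th coordinate. -/
def partialSymm (S : Set ι) (K : Set (ι → ℝ)) : Set (ι → ℝ) :=
  {x | ∃ u ∈ K, ∃ v ∈ K, (∀ m ∈ S, x m = 1 / 2 * (u m - v m)) ∧
    ∀ m, m ∉ S → u m = x m ∧ v m = x m}

/-- The reflection changing the sign of the `l`-th coordinate. -/
def flipCoord [DecidableEq ι] (l : ι) (x : ι → ℝ) : ι → ℝ := Function.update x l (-x l)

/-- `K` is contained in its reflection in the `l`-th coordinate hyperplane. -/
def FlipInvariant [DecidableEq ι] (l : ι) (K : Set (ι → ℝ)) : Prop :=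
  ∀ x ∈ K, flipCoord l x ∈ K

theorem isCompact_partialSymm {S : Set ι} {K : Set (ι → ℝ)} (hK : IsCompact K) :
    IsCompact (partialSymm S K) := by
  classical
  have hT : IsCompact ((K ×ˢ K) ∩ {p | ∀ m, m ∉ S → p.1 m = p.2 m}) := by
    refine (hK.prod hK).inter_right ?_
    simp only [Set.ofPred_forall]
    exact isClosed_iInter fun m => isClosed_iInter fun _ =>
      isClosed_eq (by fun_prop) (by fun_prop)
  convert hT.image (f := fun p m => if m ∈ S then 1 / 2 * (p.1 m - p.2 m) else p.1 m) ?_ using 1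
  · ext x
    constructor
    · rintro ⟨u, hu, v, hv, h1, h2⟩
      refine ⟨(u, v), ⟨⟨hu, hv⟩, fun m hm => (h2 m hm).1.trans (h2 m hm).2.symm⟩, ?_⟩
      funext m
      by_cases hm : m ∈ S
      · simp [hm, h1 m hm]
      · simp [hm, h2 m hm]
    · rintro ⟨⟨u, v⟩, ⟨⟨hu, hv⟩, h⟩, rfl⟩
      refine ⟨u, hu, v, hv, fun m hm => by simp [hm], fun m hm => ?_⟩
      simp only [hm, if_false, true_and]
      exact (h m hm).symm
  · refine continuous_pi fun m => ?_
    by_cases hm : m ∈ S <;> simp only [hm, if_true, if_false] <;> fun_prop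

theorem convex_partialSymm {S : Set ι} {K : Set (ι → ℝ)} (hK : Convex ℝ K) :
    Convex ℝ (partialSymm S K) := by
  rintro x ⟨u, hu, v, hv, h1, h2⟩ x' ⟨u', hu', v', hv', h1', h2'⟩ a c ha hc hac
  refine ⟨_, hK hu hu' ha hc hac, _, hK hv hv' ha hc hac, fun m hm => ?_, fun m hm => ?_⟩
  · simp only [Pi.add_apply, Pi.smul_apply, smul_eq_mul, h1 m hm, h1' m hm]
    ring
  · simp [h2 m hm, h2' m hm]

theorem neg_mem_partialSymm {S : Set ι} {K : Set (ι → ℝ)} (hK : ∀ x ∈ K, -x ∈ K) :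
    ∀ x ∈ partialSymm S K, -x ∈ partialSymm S K := by
  rintro x ⟨u, hu, v, hv, h1, h2⟩
  refine ⟨_, hK u hu, _, hK v hv, fun m hm => ?_, fun m hm => ?_⟩
  · simp only [Pi.neg_apply, h1 m hm]
    ring
  · simp [h2 m hm]

variable [DecidableEq ι]

/-- Reflecting both witnesses works, whatever `S` is; hence later moves keep the invariances already
gained. -/
theorem FlipInvariant.partialSymm {l : ι} {K : Set (ι → ℝ)} (h : FlipInvariant l K)
    (S : Set ι) : FlipInvariant l (partialSymm S K) := by
  rintro x ⟨u, hu, v, hv, h1, h2⟩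
  refine ⟨_, h u hu, _, h v hv, fun m hm => ?_, fun m hm => ?_⟩ <;>
    rcases eq_or_ne m l with rfl | hml
  · simp only [flipCoord, Function.update_self, h1 m hm]
    ring
  · simp [flipCoord, hml, h1 m hm]
  · simp [flipCoord, h2 m hm]
  · simp [flipCoord, hml, h2 m hm]

/-- Exchanging the two witnesses reflects the point. -/
theorem flipInvariant_partialSymm_singleton (l : ι) (K : Set (ι → ℝ)) :
    FlipInvariant l (partialSymm {l} K) := by
  rintro x ⟨u, hu, v, hv, h1, h2⟩
  refine ⟨v, hv, u, hu, fun m hm => ?_, fun m hm => ?_⟩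
  · obtain rfl : m = l := hm
    simp only [flipCoord, Function.update_self, h1 m rfl]
    ring
  · have hml : m ≠ l := hm
    simp [flipCoord, hml, h2 m hm]

theorem volume_le_partialSymm_singleton {n : ℕ} (l : Fin n) {K : Set (Fin n → ℝ)}
    (hK : IsCompact K) : volume K ≤ volume (partialSymm {l} K) := by
  cases n with
  | zero => exact l.elim0
  | succ m =>
    refine volume_le_of_measurePreserving midpointBrunnMinkowski_real (splitCoord l)
      (measurePreserving_splitCoord l) hK (isCompact_partialSymm hK) ?_
    intro u hu v hv x h1 h2 h3
    refine ⟨u, hu, v, hv, ?_, fun i hi => ?_⟩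
    · rintro _ rfl
      exact h3
    · obtain ⟨i, rfl⟩ := Fin.exists_succAbove_eq hi
      exact ⟨congrFun h1 i, congrFun h2 i⟩

theorem volume_le_partialSymm_compl {n : ℕ} (l : Fin n) {K : Set (Fin n → ℝ)}
    (hK : IsCompact K) : volume K ≤ volume (partialSymm {l}ᶜ K) := by
  cases n with
  | zero => exact l.elim0
  | succ m =>
    refine volume_le_of_measurePreserving (midpointBrunnMinkowski_pi m)
      ((splitCoord l).trans (ContinuousLinearEquiv.prodComm ℝ _ _))
      (Measure.measurePreserving_swap.comp (measurePreserving_splitCoord l)) hK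
      (isCompact_partialSymm hK) ?_
    intro u hu v hv x h1 h2 h3
    refine ⟨u, hu, v, hv, fun i hi => ?_, fun i hi => ?_⟩
    · obtain ⟨i, rfl⟩ := Fin.exists_succAbove_eq hi
      exact congrFun h3 i
    · obtain rfl : i = l := by simpa using hi
      exact ⟨h1, h2⟩

end partialSymm

/-! ### Polarity under a complementary pair of symmetrizations -/

/-- `elemSymm j` is affine in each variable separately. -/
theorem elemSymm_eq_average {k : ℕ} (j : ℕ) (p : Fin k) {r u v : Fin k → ℝ}
    (hp : r p = 1 / 2 * (u p + v p)) (h : ∀ i, i ≠ p → u i = r i ∧ v i = r i) :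
    elemSymm j r = 1 / 2 * (elemSymm j u + elemSymm j v) := by
  simp only [elemSymm]
  rw [← Finset.sum_add_distrib, Finset.mul_sum]
  refine Finset.sum_congr rfl fun t _ => ?_
  by_cases ht : p ∈ t
  · have hu : ∏ i ∈ t.erase p, u i = ∏ i ∈ t.erase p, r i :=
      Finset.prod_congr rfl fun i hi => (h i (Finset.ne_of_mem_erase hi)).1
    have hv : ∏ i ∈ t.erase p, v i = ∏ i ∈ t.erase p, r i :=
      Finset.prod_congr rfl fun i hi => (h i (Finset.ne_of_mem_erase hi)).2
    rw [← Finset.mul_prod_erase t r ht, ← Finset.mul_prod_erase t u ht,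
      ← Finset.mul_prod_erase t v ht, hu, hv, hp]
    ring
  · have hne : ∀ i ∈ t, i ≠ p := fun i hi hip => ht (hip ▸ hi)
    rw [Finset.prod_congr rfl fun i hi => (h i (hne i hi)).1,
      Finset.prod_congr rfl fun i hi => (h i (hne i hi)).2]
    ring

theorem elemSymm_neg {k j : ℕ} (hj : Even j) (r : Fin k → ℝ) :
    elemSymm j (fun i => -r i) = elemSymm j r := by
  refine Finset.sum_congr rfl fun t ht => ?_
  rw [Finset.prod_neg, (Finset.mem_powersetCard.1 ht).2, hj.neg_one_pow, one_mul]

theorem elemSymm_self {k : ℕ} (r : Fin k → ℝ) : elemSymm k r = ∏ i, r i := by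
  have h : Finset.powersetCard k (Finset.univ : Finset (Fin k)) = {Finset.univ} := by
    simpa using Finset.powersetCard_self (Finset.univ : Finset (Fin k))
  simp [elemSymm, h]

theorem elemSymm_self_eq_of_neg_neg {k : ℕ} {p q : Fin k} (hpq : p ≠ q) {r s : Fin k → ℝ}
    (hp : r p = -s p) (hq : r q = -s q) (h : ∀ i, i ≠ p → i ≠ q → r i = s i) :
    elemSymm k r = elemSymm k s := by
  have hmem : q ∈ Finset.univ.erase p := by simp [hpq.symm]
  rw [elemSymm_self, elemSymm_self, ← Finset.mul_prod_erase _ r (Finset.mem_univ p),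
    ← Finset.mul_prod_erase _ s (Finset.mem_univ p), ← Finset.mul_prod_erase _ r hmem,
    ← Finset.mul_prod_erase _ s hmem, hp, hq,
    Finset.prod_congr rfl fun i hi => h i (by simp at hi; exact hi.2) (by simp at hi; exact hi.1)]
  ring

/-- The function `ℰ_j` on tuples of vectors of `Fin n → ℝ`. -/
noncomputable def coordE {n k : ℕ} (j : ℕ) (x : Fin k → Fin n → ℝ) : ℝ :=
  (∑ l, elemSymm j fun i => x i l) / (k.choose j : ℝ)

/-- Replace `K p` and `K q` by symmetrizations that are complementary with respect to the
`l`-th coordinate. -/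
def symmPair {n k : ℕ} (p q : Fin k) (l : Fin n) (K : Fin k → Set (Fin n → ℝ)) (i : Fin k) :
    Set (Fin n → ℝ) :=
  if i = p then partialSymm {l} (K i) else if i = q then partialSymm {l}ᶜ (K i) else K i

theorem polarityCondition_symmPair {n k j : ℕ} {p q : Fin k} (hpq : p ≠ q) {l : Fin n}
    {K : Fin k → Set (Fin n → ℝ)} (hneg : ∀ x ∈ K q, -x ∈ K q)
    (hpol : PolarityCondition (coordE j) K)
    (hcase : j = k ∨ Even j ∧ ∀ i, i ≠ p → i ≠ q → FlipInvariant l (K i)) :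
    PolarityCondition (coordE j) (symmPair p q l K) := by
  intro x hx
  have hxp : x p ∈ partialSymm {l} (K p) := by simpa [symmPair] using hx p
  have hxq : x q ∈ partialSymm {l}ᶜ (K q) := by simpa [symmPair, hpq.symm] using hx q
  have hxi : ∀ i, i ≠ p → i ≠ q → x i ∈ K i := fun i hp hq => by
    simpa [symmPair, hp, hq] using hx i
  obtain ⟨y, hy, y', hy', hyl, hym⟩ := hxp
  obtain ⟨z, hz, w, hw, hzm, hzl⟩ := hxq
  replace hyl := hyl l rfl
  replace hzl := hzl l (by simp)
  -- The second tuple has `y'` at `p` and `-w` at `q`. At `l` its values should match, up to a sign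
  -- invisible to `elemSymm j`, those of `x` with `-y' l` at `p`. For `j = k` the sign changes at
  -- `p` and `q` cancel; for even `j` the remaining vectors are reflected as well, so that all signs
  -- change.
  obtain ⟨x₂, hx₂, hx₂p, hx₂q, hx₂m, hx₂l⟩ : ∃ x₂ : Fin k → Fin n → ℝ, (∀ i, x₂ i ∈ K i) ∧
      x₂ p = y' ∧ x₂ q = -w ∧ (∀ i, i ≠ p → i ≠ q → ∀ m, m ≠ l → x₂ i m = x i m) ∧
      elemSymm j (fun i => x₂ i l) = elemSymm j (fun i => if i = p then -y' l else x i l) := by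
    rcases hcase with rfl | ⟨hj, hflip⟩
    · refine ⟨fun i => if i = p then y' else if i = q then -w else x i, fun i => ?_, by simp,
        by simp [hpq.symm], fun i hp hq m _ => by simp [hp, hq], ?_⟩
      · dsimp only
        split_ifs with hp hq
        · exact hp ▸ hy'
        · exact hq ▸ hneg w hw
        · exact hxi i hp hq
      · apply elemSymm_self_eq_of_neg_neg hpq
        · simp
        · simp [hpq.symm, hzl]
        · intro i hp hq
          simp [hp, hq]
    · refine ⟨fun i => if i = p then y' else if i = q then -w else flipCoord l (x i),
        fun i => ?_, by simp, by simp [hpq.symm],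
        fun i hp hq m hm => by simp [hp, hq, flipCoord, hm], ?_⟩
      · dsimp only
        split_ifs with hp hq
        · exact hp ▸ hy'
        · exact hq ▸ hneg w hw
        · exact hflip i hp hq _ (hxi i hp hq)
      · rw [← elemSymm_neg hj]
        congr 1
        funext i
        by_cases hp : i = p
        · simp [hp]
        by_cases hq : i = q
        · simp [hq, hpq.symm, hzl]
        · simp [hp, hq, flipCoord]
  have hx₁ : ∀ i, (if i = p then y else if i = q then z else x i) ∈ K i := fun i => by
    split_ifs with hp hq
    · exact hp ▸ hy
    · exact hq ▸ hz
    · exact hxi i hp hq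
  have h1 := hpol _ hx₁
  have h2 := hpol _ hx₂
  have hsum : coordE j x = 1 / 2 * (coordE j (fun i => if i = p then y else if i = q then z else x i)
      + coordE j x₂) := by
    simp only [coordE]
    rw [← add_div, ← Finset.sum_add_distrib, mul_div_assoc', Finset.mul_sum]
    congr 1
    refine Finset.sum_congr rfl fun m _ => ?_
    -- At `l` the two tuples average in the variable `p`, elsewhere in `q`.
    rcases eq_or_ne m l with rfl | hm
    · rw [hx₂l]
      apply elemSymm_eq_average j p
      · simp only [if_true, hyl]
        ring
      · intro i hp
        by_cases hq : i = q
        · simp [hq, hpq.symm, hzl]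
        · simp [hp, hq]
    · apply elemSymm_eq_average j q
      · simp only [hpq.symm, if_true, if_false, hx₂q, hzm m hm, Pi.neg_apply]
        ring
      · intro i hq
        by_cases hp : i = p
        · simp [hp, hx₂p, hym m hm]
        · simp [hp, hq, hx₂m i hp hq m hm]
  rw [hsum]
  linarith

/-! ### Iteration over all indices and coordinates -/

theorem exists_flipInvariant {n k j : ℕ} (hk : 2 ≤ k) {K : Fin k → Set (Fin n → ℝ)}
    (hK : ∀ i, IsCompact (K i) ∧ Convex ℝ (K i) ∧ ∀ x ∈ K i, -x ∈ K i)
    (hpol : PolarityCondition (coordE j) K)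
    (hcase : j = k ∨ Even j ∧ ∀ i : Fin k, 2 ≤ (i : ℕ) → ∀ l, FlipInvariant l (K i))
    (T : Finset (Fin k × Fin n)) :
    ∃ U : Fin k → Set (Fin n → ℝ),
      (∀ i, IsCompact (U i) ∧ Convex ℝ (U i) ∧ ∀ x ∈ U i, -x ∈ U i) ∧
      PolarityCondition (coordE j) U ∧ (∀ i, volume (K i) ≤ volume (U i)) ∧
      (∀ i l, FlipInvariant l (K i) → FlipInvariant l (U i)) ∧
      ∀ a ∈ T, FlipInvariant a.2 (U a.1) := by
  induction T using Finset.induction_on with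
  | empty => exact ⟨K, hK, hpol, fun _ => le_rfl, fun _ _ h => h, by simp⟩
  | insert a T _ ih =>
    obtain ⟨p, l⟩ := a
    obtain ⟨U, hU, hUpol, hvol, hmono, hT⟩ := ih
    by_cases hdone : FlipInvariant l (U p)
    · refine ⟨U, hU, hUpol, hvol, hmono, ?_⟩
      simp only [Finset.mem_insert, forall_eq_or_imp]
      exact ⟨hdone, hT⟩
    -- If `j ≠ k`, then `p` is one of the first two indices, since the other sets are invariant from
    -- the start; `q` is the other of these two, so every remaining set is invariant.
    obtain ⟨q, hpq, hq⟩ : ∃ q, p ≠ q ∧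
        (j = k ∨ Even j ∧ ∀ i, i ≠ p → i ≠ q → FlipInvariant l (U i)) := by
      have hp2 : j = k ∨ (p : ℕ) < 2 := hcase.imp_right fun h =>
        not_le.1 fun hp => hdone (hmono p l (h.2 p hp l))
      refine ⟨if (p : ℕ) = 0 then ⟨1, hk⟩ else ⟨0, by omega⟩, ?_, ?_⟩
      · split_ifs with h <;> simp [Fin.ext_iff, h]
      · rcases hp2 with h | hp
        · exact Or.inl h
        refine hcase.imp_right fun h => ⟨h.1, fun i hip hiq => hmono i l (h.2 i ?_ l)⟩
        split_ifs at hiq with h0 <;> simp only [ne_eq, Fin.ext_iff] at hip hiq <;> omega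
    have hflip : ∀ i m, FlipInvariant m (U i) → FlipInvariant m (symmPair p q l U i) := by
      intro i m h
      unfold symmPair
      split_ifs
      exacts [h.partialSymm _, h.partialSymm _, h]
    refine ⟨symmPair p q l U, fun i => ?_,
      polarityCondition_symmPair hpq (hU q).2.2 hUpol hq, fun i => (hvol i).trans ?_,
      fun i m h => hflip i m (hmono i m h), ?_⟩
    · obtain ⟨h1, h2, h3⟩ := hU i
      unfold symmPair
      split_ifs
      exacts [⟨isCompact_partialSymm h1, convex_partialSymm h2, neg_mem_partialSymm h3⟩,
        ⟨isCompact_partialSymm h1, convex_partialSymm h2, neg_mem_partialSymm h3⟩, ⟨h1, h2, h3⟩]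
    · unfold symmPair
      split_ifs
      exacts [volume_le_partialSymm_singleton l (hU i).1, volume_le_partialSymm_compl l (hU i).1,
        le_rfl]
    · simp only [Finset.mem_insert, forall_eq_or_imp]
      refine ⟨?_, fun a ha => hflip _ _ (hT a ha)⟩
      simpa [symmPair] using flipInvariant_partialSymm_singleton l (U p)

theorem mul_mem_of_flipInvariant {n : ℕ} {K : Set (Fin n → ℝ)} (hK : ∀ l, FlipInvariant l K)
    {δ : Fin n → ℝ} (hδ : ∀ l, δ l = 1 ∨ δ l = -1) {x : Fin n → ℝ} (hx : x ∈ K) :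
    δ * x ∈ K := by
  have key : ∀ T : Finset (Fin n), (fun m => if m ∈ T then δ m * x m else x m) ∈ K := by
    intro T
    induction T using Finset.induction_on with
    | empty => simpa using hx
    | insert l T hl ih =>
      rcases hδ l with h | h
      · convert ih using 2 with m
        rcases eq_or_ne m l with rfl | hm
        · simp [hl, h]
        · simp [hm]
      · convert hK l _ ih using 1
        funext m
        rcases eq_or_ne m l with rfl | hm
        · simp [hl, h, flipCoord]
        · simp [hm, flipCoord]
  simpa [Pi.mul_def] using key Finset.univ

/-! ### Passage between `E` and coordinate space -/

section transport

variable {n : ℕ} {E : Type*} [NormedAddCommGroup E] [InnerProductSpace ℝ E]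

/-- The coordinates with respect to `b`, as a continuous linear equivalence. -/
noncomputable def coordEquiv (b : OrthonormalBasis (Fin n) ℝ E) : E ≃L[ℝ] (Fin n → ℝ) :=
  b.repr.toContinuousLinearEquiv.trans (EuclideanSpace.equiv (Fin n) ℝ)

theorem coordEquiv_apply (b : OrthonormalBasis (Fin n) ℝ E) (x : E) (l : Fin n) :
    coordEquiv b x l = b.repr x l := rfl

theorem measurePreserving_coordEquiv [FiniteDimensional ℝ E] [MeasurableSpace E] [BorelSpace E]
    (b : OrthonormalBasis (Fin n) ℝ E) : MeasurePreserving (coordEquiv b) volume volume :=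
  (PiLp.volume_preserving_ofLp (Fin n)).comp b.measurePreserving_repr

theorem coordEquiv_coordMul (b : OrthonormalBasis (Fin n) ℝ E) (δ : Fin n → ℝ) (x : E) :
    coordEquiv b (coordMul b δ x) = δ * coordEquiv b x := by
  funext l
  simp [coordEquiv_apply, coordMul, b.repr_self, Pi.single_apply]

theorem calE_eq_coordE {k : ℕ} (b : OrthonormalBasis (Fin n) ℝ E) (j : ℕ) (x : Fin k → E) :
    calE b j x = coordE j fun i => coordEquiv b (x i) := rfl

theorem IsUnconditional.flipInvariant {b : OrthonormalBasis (Fin n) ℝ E} {K : Set E}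
    (hK : IsUnconditional b K) (l : Fin n) : FlipInvariant l (coordEquiv b '' K) := by
  rintro _ ⟨x, hx, rfl⟩
  refine ⟨coordMul b (Function.update 1 l (-1)) x, (hK _ (fun m => ?_) x).2 hx, ?_⟩
  · rcases eq_or_ne m l with rfl | hm <;> simp [*]
  · rw [coordEquiv_coordMul]
    funext m
    rcases eq_or_ne m l with rfl | hm <;> simp [flipCoord, *]

theorem isUnconditional_preimage {b : OrthonormalBasis (Fin n) ℝ E} {K : Set (Fin n → ℝ)}
    (hK : ∀ l, FlipInvariant l K) : IsUnconditional b (coordEquiv b ⁻¹' K) := by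
  intro δ hδ x
  simp only [Set.mem_preimage, coordEquiv_coordMul]
  refine ⟨fun h => ?_, mul_mem_of_flipInvariant hK hδ⟩
  convert mul_mem_of_flipInvariant hK hδ h using 1
  funext l
  rcases hδ l with h | h <;> simp [h]

end transport

end Santalo

theorem mainTheorem6 {n k j : ℕ} {E : Type*} [NormedAddCommGroup E] [InnerProductSpace ℝ E]
    [FiniteDimensional ℝ E] [MeasurableSpace E] [BorelSpace E]
    (b : OrthonormalBasis (Fin n) ℝ E) (hj : 2 ≤ j) (hjk : j ≤ k)
    (K : Fin k → Set E) (hK : ∀ i, Santalo.IsSymmetricConvexBody (K i))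
    (hpol : Santalo.PolarityCondition (Santalo.calE b j) K)
    (hcase : j = k ∨
      (Even j ∧ ∀ i : Fin k, 2 ≤ (i : ℕ) → Santalo.IsUnconditional b (K i))) :
    ∃ U : Fin k → Set E,
      (∀ i, Santalo.IsConvexBody (U i) ∧ Santalo.IsUnconditional b (U i)) ∧
      Santalo.PolarityCondition (Santalo.calE b j) U ∧
      ∏ i, volume (K i) ≤ ∏ i, volume (U i) := by
  open Santalo in
  have hvolK : ∀ i, volume (coordEquiv b '' K i) = volume (K i) := fun i => by
    rw [← (measurePreserving_coordEquiv b).measure_preimage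
      ((hK i).isConvexBody.isCompact.image
        (coordEquiv b).continuous).measurableSet.nullMeasurableSet,
      (coordEquiv b).injective.preimage_image]
  obtain ⟨U, hU, hUpol, hvol, -, hflip⟩ := exists_flipInvariant (hj.trans hjk)
    (K := fun i => coordEquiv b '' K i) (j := j)
    (fun i => ⟨(hK i).isConvexBody.isCompact.image (coordEquiv b).continuous,
      (hK i).isConvexBody.convex.linear_image (coordEquiv b).toLinearMap, by
        rintro _ ⟨x, hx, rfl⟩
        refine ⟨-x, ?_, map_neg _ _⟩
        rw [(hK i).symmetric]
        simpa using hx⟩)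
    (fun x hx => by
      choose y hy hyx using hx
      have := hpol y hy
      rw [calE_eq_coordE] at this
      simpa only [hyx] using this)
    (hcase.imp_right fun h => ⟨h.1, fun i hi => (h.2 i hi).flipInvariant⟩) Finset.univ
  have hvolU : ∀ i, volume (K i) ≤ volume (coordEquiv b ⁻¹' U i) := fun i => by
    rw [(measurePreserving_coordEquiv b).measure_preimage
      (hU i).1.measurableSet.nullMeasurableSet, ← hvolK i]
    exact hvol i
  refine ⟨fun i => coordEquiv b ⁻¹' U i, fun i => ⟨?_, isUnconditional_preimage fun l =>
    hflip (i, l) (Finset.mem_univ _)⟩, fun x hx => ?_, Finset.prod_le_prod' fun i _ => hvolU i⟩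
  · have hconv : Convex ℝ (coordEquiv b ⁻¹' U i) :=
      (hU i).2.1.linear_preimage (coordEquiv b).toLinearMap
    have hcomp : IsCompact (coordEquiv b ⁻¹' U i) :=
      (coordEquiv b).toHomeomorph.isCompact_preimage.2 (hU i).1
    refine ⟨hconv, hcomp, Set.nonempty_iff_ne_empty.2 fun hempty => ?_⟩
    -- A closed convex set with empty interior equals its frontier, hence is null; but this volume
    -- is at least that of `K i`, which is positive.
    have h0 := hconv.addHaar_frontier volume
    rw [hcomp.isClosed.frontier_eq, hempty, Set.sdiff_empty] at h0
    exact (Measure.measure_pos_of_nonempty_interior volume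
      (hK i).isConvexBody.interior_nonempty).not_ge ((hvolU i).trans h0.le)
  · exact hUpol _ hx
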